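/- A multipartite tournament is a finite digraph whose vertex set can be partitioned into $\ell\ge 2$ nonempty classes such that no two vertices of the same class are joined by an arc and any two vertices of different classes are joined by exactly one arc (that is, an orientation of a complete $\ell$-partite graph). For a digraph $D$, let $\delta^+(D)$ denote its minimum out-degree. Let $k$ be a non-negative integer and let $D$ be a multipartite tournament that contains no directed triangle (directed cycle of length $3$). If $\delta^+(D)\ge 2k-1$, then $D$ contains $k$ pairwise vertex-disjoint directed cycles. -/

import Mathlib

namespace Digraph

variable {V : Type*}

/-- The set of out-neighbours of a vertex. -/
def outNeighborSet (D : Digraph V) (v : V) : Set V := {w | D.Adj v w}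

/-- The out-degree of a vertex (of a digraph on a finite vertex set). -/
noncomputable def outDegree (D : Digraph V) (v : V) : ℕ := (D.outNeighborSet v).ncard

/-- The minimum out-degree of a digraph with finite nonempty vertex set. -/
noncomputable def minOutDegree (D : Digraph V) : ℕ := ⨅ v, D.outDegree v

/-- `D` is an `ℓ`-partite tournament: its vertex set is partitioned into `ℓ` nonempty classes
(the fibres of `part`), two vertices of the same class are not joined by an arc, and two vertices
of different classes are joined by exactly one arc. That is, `D` is an orientation of a complete
`ℓ`-partite graph. -/
def IsPartiteTournament (D : Digraph V) (ℓ : ℕ) : Prop :=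
  ∃ part : V → Fin ℓ, Function.Surjective part ∧
    (∀ u v, part u = part v → ¬ D.Adj u v) ∧
    (∀ u v, part u ≠ part v → Xor (D.Adj u v) (D.Adj v u))

/-- A multipartite tournament is an `ℓ`-partite tournament for some `ℓ ≥ 2`. -/
def IsMultipartiteTournament (D : Digraph V) : Prop :=
  ∃ ℓ : ℕ, 2 ≤ ℓ ∧ D.IsPartiteTournament ℓ

/-- A directed cycle of `D`: distinct vertices `x₀, …, x_{m-1}` with `m ≥ 2` and arcs
`x₀ → x₁ → ⋯ → x_{m-1} → x₀` (`finRotate m` is the cyclic successor on `Fin m`). -/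
structure Dicycle (D : Digraph V) where
  /-- the number of vertices of the cycle -/
  length : ℕ
  two_le_length : 2 ≤ length
  /-- the vertices in cyclic order -/
  vertex : Fin length → V
  injective : Function.Injective vertex
  adj : ∀ i, D.Adj (vertex i) (vertex (finRotate length i))

/-- The vertex set of a directed cycle. -/
def Dicycle.support {D : Digraph V} (C : D.Dicycle) : Set V := Set.range C.vertex

end Digraph

/-!
In a multipartite tournament without directed triangle, dominance passes along arcs: if
`v → u → w` and `v`, `w` lie in different classes, then `v → w`
(`adj_of_adj_of_adj_of_no_triangle`). This forces every minimal nonempty out-closed vertex set `S`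
to meet at most two classes (`bipartite_of_minimal_outClosed`). Indeed a vertex `w ∈ S` dominated
by all of `K ∩ S`, for a class `K` not containing `w`, would pass this property on to its
out-neighbours, giving a smaller out-closed set; so every vertex of `S` has an out-neighbour in
every other class met by `S`. If three classes are met, choose `w ∈ S` outside `K` with the most
in-neighbours in `K ∩ S`, an arc `w → v` with `v ∈ K`, and an arc `v → z` into a third class. Then
`w → z`, so `z` inherits all the in-neighbours of `w` in `K`, and has `v` in addition: a
contradiction.

Since `S` is out-closed, out-degrees are not lost by passing to `S`. A bipartite tournament
with positive minimum out-degree contains a directed 4-cycle (`exists_four_cycle`), and a vertex has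
at most two out-neighbours on it, since they all lie in one class. Hence deleting the 4-cycle lowers
the minimum out-degree by at most 2, and induction on `k` applies
(`exists_disjoint_dicycles_of_bipartite`).
-/

namespace Digraph

variable {V : Type*} {D : Digraph V}

/-! ### Short directed cycles -/

/-- The directed triangle `a → b → c → a`. -/
def Dicycle.triangle {a b c : V} (hab : D.Adj a b) (hbc : D.Adj b c) (hca : D.Adj c a)
    (h₁ : a ≠ b) (h₂ : b ≠ c) (h₃ : c ≠ a) : D.Dicycle where
  length := 3
  two_le_length := by norm_num
  vertex := ![a, b, c]
  injective := by
    intro i j h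
    fin_cases i <;> fin_cases j <;> simp_all
  adj := by
    intro i
    fin_cases i <;> simpa [finRotate_apply]

/-- The directed 4-cycle `a → b → c → d → a`. -/
def Dicycle.quadrangle {a b c d : V} (hab : D.Adj a b) (hbc : D.Adj b c) (hcd : D.Adj c d)
    (hda : D.Adj d a) (h₁ : a ≠ b) (h₂ : b ≠ c) (h₃ : c ≠ d) (h₄ : d ≠ a) (h₅ : a ≠ c)
    (h₆ : b ≠ d) : D.Dicycle where
  length := 4
  two_le_length := by norm_num
  vertex := ![a, b, c, d]
  injective := by
    intro i j h
    fin_cases i <;> fin_cases j <;> simp_all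
  adj := by
    intro i
    fin_cases i <;> simpa [finRotate_apply]

/-! ### Bipartite tournaments -/

section

variable {ι : Type*} {part : V → ι}

/-- In a nonempty bipartite tournament in which every vertex has an out-neighbour there is a
directed 4-cycle. Bipartiteness of the subdigraph induced by `S` is encoded by the condition that
the ends of a path with two arcs lie in the same class. -/
theorem exists_four_cycle [Finite V]
    (h_same : ∀ u v, part u = part v → ¬ D.Adj u v)
    (h_diff : ∀ u v, part u ≠ part v → Xor (D.Adj u v) (D.Adj v u))
    {S : Set V} (hS : S.Nonempty)
    (h_bip : ∀ x ∈ S, ∀ y ∈ S, ∀ z ∈ S, D.Adj x y → D.Adj y z → part x = part z)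
    (h_out : ∀ v ∈ S, ∃ w ∈ S, D.Adj v w) :
    ∃ a ∈ S, ∃ b ∈ S, ∃ c ∈ S, ∃ d ∈ S,
      D.Adj a b ∧ D.Adj b c ∧ D.Adj c d ∧ D.Adj d a := by
  obtain ⟨a, ha, h_max⟩ :=
    Set.exists_max_image S (fun w => {u | u ∈ S ∧ D.Adj u w}.ncard) S.toFinite hS
  obtain ⟨b, hb, hab⟩ := h_out a ha
  obtain ⟨c, hc, hbc⟩ := h_out b hb
  have hac := h_bip a ha b hb c hc hab hbc
  have hba : ¬ D.Adj b a := fun h => by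
    rcases h_diff a b (fun e => h_same _ _ e hab) with h' | h' <;> tauto
  -- By the choice of `a`, the in-neighbourhood of `c`, which contains `b`, does not contain
  -- that of `a`.
  obtain ⟨d, ⟨hd, hda⟩, hdc⟩ : ∃ d, (d ∈ S ∧ D.Adj d a) ∧ ¬ D.Adj d c := by
    by_contra! h
    have h_lt : {u | u ∈ S ∧ D.Adj u a}.ncard < {u | u ∈ S ∧ D.Adj u c}.ncard :=
      Set.ncard_lt_ncard ⟨fun u hu => ⟨hu.1, h u hu⟩, fun h' => hba (h' ⟨hb, hbc⟩).2⟩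
    exact absurd (h_max c hc) (not_le.2 h_lt)
  have hcd : D.Adj c d := by
    rcases h_diff c d (fun e => h_same d a (e.symm.trans hac.symm) hda) with h | h
    · exact h.1
    · exact absurd h.1 hdc
  exact ⟨a, ha, b, hb, c, hc, d, hd, hab, hbc, hcd, hda⟩

/-- A bipartite tournament with minimum out-degree at least `2 * k - 1` has `k` pairwise disjoint
directed cycles. -/
theorem exists_disjoint_dicycles_of_bipartite [Finite V]
    (h_same : ∀ u v, part u = part v → ¬ D.Adj u v)
    (h_diff : ∀ u v, part u ≠ part v → Xor (D.Adj u v) (D.Adj v u)) (k : ℕ) :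
    ∀ {S : Set V}, S.Nonempty →
    (∀ x ∈ S, ∀ y ∈ S, ∀ z ∈ S, D.Adj x y → D.Adj y z → part x = part z) →
    (∀ v ∈ S, 2 * k ≤ (D.outNeighborSet v ∩ S).ncard + 1) →
    ∃ C : Fin k → D.Dicycle, (∀ i, (C i).support ⊆ S) ∧
      ∀ i j, i ≠ j → Disjoint (C i).support (C j).support := by
  induction k with
  | zero => exact fun _ _ _ => ⟨Fin.elim0, fun i => i.elim0, fun i => i.elim0⟩
  | succ k ih =>
    intro S hS h_bip h_deg
    obtain ⟨a, ha, b, hb, c, hc, d, hd, hab, hbc, hcd, hda⟩ :=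
      exists_four_cycle h_same h_diff hS h_bip fun v hv => by
        obtain ⟨w, hw⟩ := Set.nonempty_of_ncard_ne_zero
          (s := D.outNeighborSet v ∩ S) (by have := h_deg v hv; omega)
        exact ⟨w, hw.2, hw.1⟩
    have h_ne : ∀ {u v}, D.Adj u v → part u ≠ part v := fun h e => h_same _ _ e h
    have h_asymm : ∀ {u v}, D.Adj u v → ¬ D.Adj v u := fun {u v} h h' => by
      rcases h_diff u v (h_ne h) with h'' | h'' <;> tauto
    have h_irrefl : ∀ {u v}, D.Adj u v → u ≠ v := fun h e => h_ne h (congrArg part e)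
    have hac : a ≠ c := by rintro rfl; exact h_asymm hab hbc
    have hbd : b ≠ d := by rintro rfl; exact h_asymm hab hda
    let Q : D.Dicycle := Dicycle.quadrangle hab hbc hcd hda (h_irrefl hab) (h_irrefl hbc)
      (h_irrefl hcd) (h_irrefl hda) hac hbd
    have hQ : Q.support = {a, b, c, d} := by
      change Set.range ![a, b, c, d] = _
      simp only [Matrix.range_cons, Matrix.range_empty, Set.union_empty, Set.singleton_union]
    have hQS : Q.support ⊆ S := by
      rw [hQ]; rintro x (rfl | rfl | rfl | rfl) <;> assumption
    -- The out-neighbours that a vertex has on the 4-cycle all lie in one class, so they are among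
    -- two opposite vertices of the cycle.
    have h_two : ∀ x ∈ S, (D.outNeighborSet x ∩ Q.support).ncard ≤ 2 := by
      intro x hx
      have hp := h_bip a ha b hb c hc hab hbc
      have hq := h_bip b hb c hc d hd hbc hcd
      by_cases hxa : D.Adj x a ∨ D.Adj x c
      · have hxb : part x = part b := by
          rcases hxa with h | h
          · exact h_bip x hx a ha b hb h hab
          · exact (h_bip x hx c hc d hd h hcd).trans hq.symm
        refine (Set.ncard_le_ncard (t := {a, c}) ?_).trans ((Set.ncard_insert_le _ _).trans (by simp))
        rintro y ⟨hy, hyQ⟩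
        change D.Adj x y at hy
        rw [hQ] at hyQ
        rcases hyQ with rfl | rfl | rfl | rfl
        · simp
        · exact absurd hxb (h_ne hy)
        · simp
        · exact absurd (hxb.trans hq) (h_ne hy)
      · refine (Set.ncard_le_ncard (t := {b, d}) ?_).trans ((Set.ncard_insert_le _ _).trans (by simp))
        rintro y ⟨hy, hyQ⟩
        change D.Adj x y at hy
        rw [hQ] at hyQ
        rcases hyQ with rfl | rfl | rfl | rfl <;> simp_all
    have h_deg' : ∀ x ∈ S, 2 * k ≤ (D.outNeighborSet x ∩ (S \ Q.support)).ncard + 1 := by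
      intro x hx
      have h₁ : D.outNeighborSet x ∩ S ⊆
          (D.outNeighborSet x ∩ Q.support) ∪ (D.outNeighborSet x ∩ (S \ Q.support)) := by
        intro y hy
        by_cases h : y ∈ Q.support
        · exact Or.inl ⟨hy.1, h⟩
        · exact Or.inr ⟨hy.1, hy.2, h⟩
      have h₂ := (Set.ncard_le_ncard h₁).trans (Set.ncard_union_le _ _)
      have := h_two x hx
      have := h_deg x hx
      omega
    obtain ⟨C, hCS, hC⟩ : ∃ C : Fin k → D.Dicycle, (∀ i, (C i).support ⊆ S \ Q.support) ∧
        ∀ i j, i ≠ j → Disjoint (C i).support (C j).support := by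
      rcases Nat.eq_zero_or_pos k with rfl | hk
      · exact ⟨Fin.elim0, fun i => i.elim0, fun i => i.elim0⟩
      · refine ih ?_ (fun x hx y hy z hz => h_bip x hx.1 y hy.1 z hz.1)
          fun v hv => h_deg' v hv.1
        exact (Set.nonempty_of_ncard_ne_zero (s := D.outNeighborSet a ∩ (S \ Q.support))
          (by have := h_deg' a ha; omega)).mono Set.inter_subset_right
    have hQC : ∀ i, Disjoint Q.support (C i).support := fun i =>
      Set.disjoint_left.2 fun y hy hy' => (hCS i hy').2 hy
    refine ⟨Fin.cons Q C, fun i => ?_, fun i j hij => ?_⟩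
    · cases i using Fin.cases with
      | zero => simpa using hQS
      | succ i => simpa using (hCS i).trans Set.sdiff_subset
    · cases i using Fin.cases with
      | zero =>
        cases j using Fin.cases with
        | zero => exact absurd rfl hij
        | succ j => simpa using hQC j
      | succ i =>
        cases j using Fin.cases with
        | zero => simpa using (hQC i).symm
        | succ j => simpa using hC i j fun h => hij (congrArg Fin.succ h)

/-! ### Minimal out-closed sets without directed triangles -/

/-- In the absence of directed triangles, adjacency is transitive across different classes. -/
theorem adj_of_adj_of_adj_of_no_triangle
    (h_same : ∀ u v, part u = part v → ¬ D.Adj u v)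
    (h_diff : ∀ u v, part u ≠ part v → Xor (D.Adj u v) (D.Adj v u))
    (h_tri : ∀ C : D.Dicycle, C.length ≠ 3) {u v w : V} (huv : D.Adj u v) (hvw : D.Adj v w)
    (huw : part u ≠ part w) : D.Adj u w := by
  rcases h_diff u w huw with h | h
  · exact h.1
  · have h_ne : ∀ {x y}, D.Adj x y → x ≠ y := fun h e => h_same _ _ (congrArg part e) h
    exact absurd rfl
      (h_tri (Dicycle.triangle huv hvw h.1 (h_ne huv) (h_ne hvw) (h_ne h.1)))

/-- A set of vertices is out-closed if no arc leaves it. -/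
def OutClosed (D : Digraph V) (S : Set V) : Prop := ∀ ⦃u v⦄, u ∈ S → D.Adj u v → v ∈ S

/-- In a minimal nonempty out-closed set `S`, every vertex has an out-neighbour in every other
class that `S` meets. -/
theorem exists_adj_of_minimal_outClosed
    (h_same : ∀ u v, part u = part v → ¬ D.Adj u v)
    (h_diff : ∀ u v, part u ≠ part v → Xor (D.Adj u v) (D.Adj v u))
    (h_tri : ∀ C : D.Dicycle, C.length ≠ 3) {S : Set V}
    (hS : Minimal (fun T : Set V => T.Nonempty ∧ D.OutClosed T) S)
    {w x : V} (hw : w ∈ S) (hx : x ∈ S) (hwx : part w ≠ part x) :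
    ∃ v ∈ S, part v = part x ∧ D.Adj w v := by
  by_contra! h
  -- The vertices outside the class of `x` that are dominated by all members of this class in `S`.
  let T : Set V := {y | y ∈ S ∧ part y ≠ part x ∧ ∀ v ∈ S, part v = part x → D.Adj v y}
  have hT : T.Nonempty ∧ D.OutClosed T := by
    refine ⟨⟨w, hw, hwx, fun v hv hvx => ?_⟩, ?_⟩
    · rcases h_diff v w (fun e => hwx (e.symm.trans hvx)) with h' | h'
      · exact h'.1
      · exact absurd h'.1 (h v hv hvx)
    · rintro y z ⟨hy, hyx, hdom⟩ hyz
      have hz : z ∈ S := hS.prop.2 hy hyz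
      have hzx : part z ≠ part x := by
        intro hzx
        have hzy := hdom z hz hzx
        rcases h_diff y z (fun e => h_same _ _ e hyz) with h' | h' <;> tauto
      exact ⟨hz, hzx, fun v hv hvx => adj_of_adj_of_adj_of_no_triangle h_same h_diff h_tri
        (hdom v hv hvx) hyz fun e => hzx (e.symm.trans hvx)⟩
  exact (hS.le_of_le hT (fun y hy => hy.1) hx).2.1 rfl

/-- A minimal nonempty out-closed set meets at most two classes. -/
theorem bipartite_of_minimal_outClosed [Finite V]
    (h_same : ∀ u v, part u = part v → ¬ D.Adj u v)
    (h_diff : ∀ u v, part u ≠ part v → Xor (D.Adj u v) (D.Adj v u))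
    (h_tri : ∀ C : D.Dicycle, C.length ≠ 3) {S : Set V}
    (hS : Minimal (fun T : Set V => T.Nonempty ∧ D.OutClosed T) S)
    {x y z : V} (hx : x ∈ S) (hy : y ∈ S) (hz : z ∈ S)
    (hxy : part x ≠ part y) (hyz : part y ≠ part z) : part x = part z := by
  by_contra hxz
  obtain ⟨w, ⟨hw, hwx⟩, h_max⟩ := Set.exists_max_image {w | w ∈ S ∧ part w ≠ part x}
    (fun w => {u | (u ∈ S ∧ part u = part x) ∧ D.Adj u w}.ncard) (Set.toFinite _)
    ⟨y, hy, hxy.symm⟩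
  obtain ⟨v, hv, hvx, hwv⟩ :=
    exists_adj_of_minimal_outClosed h_same h_diff h_tri hS hw hx hwx
  -- One of the classes of `y` and `z` differs from the class of `w`.
  obtain ⟨t, ht, htx, htw⟩ : ∃ t ∈ S, part t ≠ part x ∧ part t ≠ part w := by
    by_cases h : part y = part w
    · exact ⟨z, hz, fun e => hxz e.symm, fun e => hyz (h.trans e.symm)⟩
    · exact ⟨y, hy, hxy.symm, h⟩
  obtain ⟨r, hr, hrt, hvr⟩ := exists_adj_of_minimal_outClosed h_same h_diff h_tri hS hv ht
    (fun e => htx (e.symm.trans hvx))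
  have hrx : part r ≠ part x := hrt ▸ htx
  have hwr : D.Adj w r := adj_of_adj_of_adj_of_no_triangle h_same h_diff h_tri hwv hvr
    fun e => htw (hrt.symm.trans e.symm)
  have hvw : ¬ D.Adj v w := fun h => by
    rcases h_diff v w (fun e => hwx (e.symm.trans hvx)) with h' | h' <;> tauto
  have h_lt : {u | (u ∈ S ∧ part u = part x) ∧ D.Adj u w}.ncard <
      {u | (u ∈ S ∧ part u = part x) ∧ D.Adj u r}.ncard :=
    Set.ncard_lt_ncard ⟨fun u hu => ⟨hu.1, adj_of_adj_of_adj_of_no_triangle h_same h_diff h_tri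
      hu.2 hwr fun e => hrx (e.symm.trans hu.1.2)⟩, fun h => hvw (h ⟨⟨hv, hvx⟩, hvr⟩).2⟩
  exact absurd (h_max r ⟨hr, hrx⟩) (not_le.2 h_lt)

end

end Digraph

theorem mainTheorem5 {V : Type*} [Finite V] (D : Digraph V) (hD : D.IsMultipartiteTournament)
    (hC3 : ∀ C : D.Dicycle, C.length ≠ 3) (k : ℕ)
    (hdeg : 2 * (k : ℤ) - 1 ≤ (D.minOutDegree : ℤ)) :
    ∃ C : Fin k → D.Dicycle,
      ∀ i j, i ≠ j → Disjoint (C i).support (C j).support := by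
  obtain ⟨ℓ, hℓ, part, h_surj, h_same, h_diff⟩ := hD
  obtain ⟨v₀, -⟩ := h_surj ⟨0, by omega⟩
  obtain ⟨S, hS⟩ : ∃ S, Minimal (fun T : Set V => T.Nonempty ∧ D.OutClosed T) S :=
    exists_minimal_of_wellFoundedLT _ ⟨Set.univ, ⟨v₀, trivial⟩, fun _ _ _ _ => trivial⟩
  obtain ⟨C, -, hC⟩ := Digraph.exists_disjoint_dicycles_of_bipartite h_same h_diff k hS.prop.1
    (fun x hx y hy z hz hxy hyz => Digraph.bipartite_of_minimal_outClosed h_same h_diff hC3 hS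
      hx hy hz (fun e => h_same _ _ e hxy) (fun e => h_same _ _ e hyz))
    (fun v hv => by
      have h_eq : D.outNeighborSet v ∩ S = D.outNeighborSet v :=
        Set.inter_eq_left.2 fun w hw => hS.prop.2 hv hw
      have h_le : D.minOutDegree ≤ D.outDegree v := ciInf_le (OrderBot.bddBelow _) v
      rw [h_eq]
      change 2 * k ≤ D.outDegree v + 1
      omega)
  exact ⟨C, hC⟩
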